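/- Let $G=(V,E)$ be a finite simple graph whose complement $\bar G$ is chordal, that is, $\bar G$ has no induced cycle of length at least $4$. Let $k$ be a field, let $I(G)=(x_ix_j : \{i,j\}\in E)\subseteq k[x_v : v\in V]$ be the edge ideal of $G$, and let $L=L(I(G))$ be its lcm-lattice, i.e. the set of least common multiples of all subsets of the minimal monomial generating set of $I(G)$ (with $1$ as the lcm of the empty set), ordered by divisibility. Then the order complex of the proper part $L\setminus\{\hat 0,\hat 1\}$, i.e. the simplicial complex of all chains of $L$ that contain neither its least element $\hat 0$ nor its greatest element $\hat 1$, is constructible. Here simplicial complexes contain the empty face, of dimension $-1$, and constructibility is defined recursively: a pure simplicial complex $\Delta$ is constructible if either $\Delta$ is a simplex (the complex of all subsets of a finite set; the set may be empty, which gives $\Delta=\{\emptyset\}$), or $\Delta=\Delta_1\cup\Delta_2$ where $\Delta_1$, $\Delta_2$ and $\Delta_1\cap\Delta_2$ are constructible and $\dim\Delta_1=\dim\Delta_2=\dim(\Delta_1\cap\Delta_2)+1$. -/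

import Mathlib

namespace LcmEdge

/-! ### Chordal graphs and edge ideals -/

/-- A graph is chordal if it has no induced cycle of length at least four. -/
def IsChordal {V : Type*} (G : SimpleGraph V) : Prop :=
  ∀ n : ℕ, 4 ≤ n → IsEmpty (SimpleGraph.cycleGraph n ↪g G)

/-- The edge ideal of `G` in the polynomial ring `k[x_v | v ∈ V]`: it is generated by the
monomials `x_i x_j` with `{i, j}` an edge of `G`. -/
noncomputable def edgeIdeal (k : Type*) [Field k] {V : Type*} (G : SimpleGraph V) :
    Ideal (MvPolynomial V k) :=
  Ideal.span {f | ∃ i j : V, G.Adj i j ∧ f = MvPolynomial.X i * MvPolynomial.X j}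

/-! ### The lcm-lattice of a monomial ideal

A monomial `x^m` is represented by its exponent vector `m : V →₀ ℕ`.  Divisibility of monomials is
the (pointwise) order `≤` on exponent vectors, and the least common multiple is the join `⊔`. -/

/-- The minimal monomial generators of a monomial ideal: the monomials of `I` that are minimal
under divisibility. -/
def minGens {k : Type*} [Field k] {V : Type*} (I : Ideal (MvPolynomial V k)) : Set (V →₀ ℕ) :=
  {m | Minimal (fun a : V →₀ ℕ => MvPolynomial.monomial a (1 : k) ∈ I) m}

/-- The lcm-lattice of a monomial ideal: the least common multiples of all sets of minimal
monomial generators, the empty set (with lcm `1 = x^0`) included. As a type it is ordered by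
divisibility. -/
def lcmLattice {k : Type*} [Field k] {V : Type*} (I : Ideal (MvPolynomial V k)) :
    Set (V →₀ ℕ) :=
  {m | ∃ S : Finset (V →₀ ℕ), (∀ a ∈ S, a ∈ minGens I) ∧ m = S.sup id}

/-- The proper part of a poset: all elements other than the least and the greatest one. -/
abbrev ProperPart (P : Type*) [PartialOrder P] : Type _ := {x : P // ¬ IsBot x ∧ ¬ IsTop x}

/-! ### Simplicial complexes

A simplicial complex is a downward closed family of finite sets, that is, a term of
`LowerSet (Finset α)`; the empty set counts as a face (of dimension `-1`).  Union and intersection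
of complexes are `⊔` and `⊓`. -/

/-- The order complex of a poset: its faces are the finite chains. -/
def orderComplex (P : Type*) [PartialOrder P] : LowerSet (Finset P) where
  carrier := {s | IsChain (· ≤ ·) (s : Set P)}
  lower' _ _ hts hs := IsChain.mono (Finset.coe_subset.2 hts) hs

/-- The dimension of a complex, the maximum of `|F| - 1` over its faces `F`. It is used below only
for complexes that have a face and whose faces have bounded size. -/
noncomputable def dim {α : Type*} (Δ : LowerSet (Finset α)) : ℤ :=
  ((sSup (Finset.card '' (Δ : Set (Finset α))) : ℕ) : ℤ) - 1

/-- A complex is pure if all its facets have the same dimension. -/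
def IsPure {α : Type*} (Δ : LowerSet (Finset α)) : Prop :=
  ∀ F F' : Finset α, Maximal (· ∈ Δ) F → Maximal (· ∈ Δ) F' → F.card = F'.card

/-- Constructible complexes. A simplex (the complex of all subsets of a finite set `F`; for
`F = ∅` this is the complex `{∅}`) is constructible, and so is a pure complex `Δ₁ ∪ Δ₂` such that
`Δ₁`, `Δ₂` and `Δ₁ ∩ Δ₂` are constructible and
`dim Δ₁ = dim Δ₂ = dim (Δ₁ ∩ Δ₂) + 1`. -/
inductive IsConstructible {α : Type*} : LowerSet (Finset α) → Prop
  | simplex (F : Finset α) : IsConstructible (LowerSet.Iic F)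
  | union (Δ₁ Δ₂ : LowerSet (Finset α)) :
      IsPure (Δ₁ ⊔ Δ₂) →
      IsConstructible Δ₁ → IsConstructible Δ₂ → IsConstructible (Δ₁ ⊓ Δ₂) →
      dim Δ₁ = dim Δ₂ → dim Δ₂ = dim (Δ₁ ⊓ Δ₂) + 1 →
      IsConstructible (Δ₁ ⊔ Δ₂)

end LcmEdge

/-! Monomials in the lcm-lattice correspond to unions of edges of `G`, that is, to vertex sets `W`
without isolated vertices in `G[W]`. The proper part consists of the nonempty ones other than the
largest, `T`. Chordality of the complement enters twice. First, two disjoint edges of `G` are always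
joined by an edge, so a nonempty such set grows to any larger one by adding single vertices
(`HasNoIsolated.exists_insert`); all maximal chains then have the same length. Second, Dirac's
theorem gives an elimination order of simplicial vertices of the complement, and listing edges star
by star in that order gives linear quotients. Chains above `z` form a cone over the chains above the
one-vertex extensions of `z`, and being above both `z` and `z'` means being above `z ∪ z'`. For
one-vertex extensions of a common set these unions are again one-vertex extensions, so induction
proves constructibility (`isConstructibleOfCard_chainsAbove`). Linear quotients reduce the gluing of
the edges, the atoms, to this case. -/

namespace LcmEdge

/-! ### Chordal graphs and Dirac's theorem -/

section Chordal

variable {V : Type*} {H : SimpleGraph V}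

lemma cycleGraph_adj_iff_of_lt {n : ℕ} {i j : Fin n} (h : i < j) :
    (SimpleGraph.cycleGraph n).Adj i j ↔ j.val = i.val + 1 ∨ i.val = 0 ∧ j.val + 1 = n := by
  have h' : i.val < j.val := h
  rw [SimpleGraph.cycleGraph_adj', Fin.coe_sub_iff_lt.2 h, Fin.sub_val_of_le h.le]
  have := j.isLt
  omega

/-- An induced path with both ends adjacent to a further vertex, which is adjacent to no other
vertex of the path, closes to an induced cycle, so it has length one in a chordal graph. -/
lemma IsChordal.not_exists_induced_cycle (hH : IsChordal H) {d : ℕ} (hd : 2 ≤ d) (p : ℕ → V)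
    (v : V) (hinj : ∀ i j, i < j → j ≤ d → p i ≠ p j)
    (hp : ∀ i j, i < j → j ≤ d → (H.Adj (p i) (p j) ↔ j = i + 1))
    (hne : ∀ i ≤ d, p i ≠ v) (hv : ∀ i ≤ d, (H.Adj (p i) v ↔ i = 0 ∨ i = d)) : False := by
  let q : Fin (d + 2) → V := fun i => if i.val ≤ d then p i.val else v
  have hlt : ∀ i j : Fin (d + 2), i < j → q i ≠ q j ∧
      (H.Adj (q i) (q j) ↔ (SimpleGraph.cycleGraph (d + 2)).Adj i j) := by
    intro i j hij
    rw [cycleGraph_adj_iff_of_lt hij]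
    have hij' : i.val < j.val := hij
    have hj := j.isLt
    have hi : i.val ≤ d := by omega
    by_cases hjd : j.val ≤ d
    · simp only [q, hi, hjd, if_true]
      exact ⟨hinj _ _ hij' hjd, (hp _ _ hij' hjd).trans (by omega)⟩
    · simp only [q, hi, hjd, if_true, if_false]
      exact ⟨hne _ hi, (hv _ hi).trans (by omega)⟩
  have hq : Function.Injective q := by
    intro i j h
    rcases lt_trichotomy i j with hij | hij | hij
    · exact absurd h (hlt _ _ hij).1
    · exact hij
    · exact absurd h.symm (hlt _ _ hij).1
  refine (hH (d + 2) (by omega)).false ⟨⟨q, hq⟩, ?_⟩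
  intro i j
  change H.Adj (q i) (q j) ↔ _
  rcases lt_trichotomy i j with hij | hij | hij
  · exact (hlt _ _ hij).2
  · simp [hij]
  · exact (H.adj_comm _ _).trans ((hlt j i hij).2.trans (SimpleGraph.adj_comm _ _ _))

/-- The graph with the edges of `H` inside `M`. -/
def edgesWithin (H : SimpleGraph V) (M : Set V) : SimpleGraph V where
  Adj a b := H.Adj a b ∧ a ∈ M ∧ b ∈ M
  symm := ⟨fun _ _ h => ⟨h.1.symm, h.2.2, h.2.1⟩⟩
  loopless := ⟨fun _ h => H.loopless.irrefl _ h.1⟩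

/-- A chord would shortcut the geodesic. -/
lemma geodesic_adj_iff {K : SimpleGraph V} {x y : V} (p : K.Walk x y)
    (hp : p.length = K.dist x y) {i j : ℕ} (hij : i < j) (hj : j ≤ p.length) :
    K.Adj (p.getVert i) (p.getVert j) ↔ j = i + 1 := by
  constructor
  · intro h
    have := K.dist_le ((p.take i).append (SimpleGraph.Walk.cons h (p.drop j)))
    simp only [SimpleGraph.Walk.length_append, SimpleGraph.Walk.length_cons,
      SimpleGraph.Walk.take_length, SimpleGraph.Walk.drop_length] at this
    omega
  · rintro rfl
    exact p.adj_getVert_succ (by omega)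

/-- In a chordal graph, two neighbours of `v` which are connected by a path through
non-neighbours of `v` are adjacent. -/
lemma IsChordal.adj_of_reachable (hH : IsChordal H) {v x y : V} {M : Set V}
    (hM : ∀ w ∈ M, w ≠ v ∧ ¬ H.Adj v w) (hx : H.Adj v x) (hy : H.Adj v y) (hxy : x ≠ y)
    (hr : (edgesWithin H (insert x (insert y M))).Reachable x y) : H.Adj x y := by
  by_contra hna
  set K := edgesWithin H (insert x (insert y M)) with hK
  have hna' : ¬ K.Adj x y := fun h => hna h.1
  have hd := hr.one_lt_dist_of_ne_of_not_adj hxy hna'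
  obtain ⟨p, hp⟩ := hr.exists_walk_length_eq_dist
  have hpath := p.isPath_of_length_eq_dist hp
  have hmem : ∀ i ≤ p.length, p.getVert i ∈ insert x (insert y M) := by
    intro i hi
    rcases hi.lt_or_eq with hi | rfl
    · exact (p.adj_getVert_succ hi).2.1
    · simp
  have hinj : ∀ i j, i < j → j ≤ p.length → p.getVert i ≠ p.getVert j := by
    intro i j hij hj h
    exact hij.ne (hpath.getVert_injOn (show i ≤ p.length by omega) hj h)
  -- The geodesic has length at least 2, is induced in `H` because `K` keeps all edges between its
  -- vertices, and has its interior in `M`; with `v` it closes to a forbidden cycle.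
  refine hH.not_exists_induced_cycle (d := p.length) (by omega) p.getVert v hinj ?_ ?_ ?_
  · intro i j hij hj
    rw [← geodesic_adj_iff p hp hij hj]
    exact ⟨fun h => ⟨h, hmem _ (by omega), hmem _ hj⟩, fun h => h.1⟩
  · intro i hi h
    rcases hmem i hi with h' | h' | h'
    · exact hx.ne (h ▸ h')
    · exact hy.ne (h ▸ h')
    · exact (hM _ h').1 h
  · intro i hi
    constructor
    · intro h
      rcases hmem i hi with h' | h' | h'
      · exact Or.inl ((hpath.getVert_eq_start_iff hi).1 h')
      · exact Or.inr ((hpath.getVert_eq_end_iff hi).1 h')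
      · exact absurd h.symm (hM _ h').2
    · rintro (rfl | rfl)
      · simpa using hx.symm
      · simpa using hy.symm

/-- The neighbours of `w` in `S` are pairwise adjacent. -/
def IsSimplicialIn (H : SimpleGraph V) (S : Finset V) (w : V) : Prop :=
  ∀ a ∈ S, ∀ b ∈ S, H.Adj w a → H.Adj w b → a ≠ b → H.Adj a b

/-- Dirac's theorem: in a chordal graph, each vertex which is not adjacent to all others has a
simplicial non-neighbour. -/
theorem IsChordal.exists_simplicial_nonneighbor (hH : IsChordal H) (S : Finset V) :
    ∀ v ∈ S, ∀ c ∈ S, c ≠ v → ¬ H.Adj v c →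
      ∃ w ∈ S, w ≠ v ∧ ¬ H.Adj v w ∧ IsSimplicialIn H S w := by
  classical
  induction S using Finset.strongInduction with
  | H S ih =>
  intro v hv c hc hcv hvc
  let M : Set V := {w | w ∈ S ∧ w ≠ v ∧ ¬ H.Adj v w}
  let K := edgesWithin H M
  -- `C` is the component of `c` among the non-neighbours of `v`, and `N` its boundary in `S`: a
  -- clique of neighbours of `v`. Vertices of `C` have all their `S`-neighbours in `N ∪ C`, which
  -- misses `v`, so induction applies there.
  let C := S.filter fun w => w ∈ M ∧ K.Reachable c w
  let N := S.filter fun s => s ∉ C ∧ ∃ w ∈ C, H.Adj s w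
  have hcC : c ∈ C := by simp [C, M, hc, hcv, hvc]
  have hCM : ∀ w ∈ C, w ∈ M := fun w hw => (Finset.mem_filter.1 hw).2.1
  have hNv : ∀ s ∈ N, H.Adj v s := by
    intro s hs
    obtain ⟨hsS, hsC, w, hw, hsw⟩ := Finset.mem_filter.1 hs
    by_contra hvs
    have hsM : s ∈ M := ⟨hsS, by rintro rfl; exact (hCM w hw).2.2 hsw, hvs⟩
    refine hsC (Finset.mem_filter.2 ⟨hsS, hsM, (Finset.mem_filter.1 hw).2.2.trans ?_⟩)
    exact SimpleGraph.Adj.reachable (G := K) ⟨hsw.symm, hCM w hw, hsM⟩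
  have hN : ∀ x ∈ N, ∀ y ∈ N, x ≠ y → H.Adj x y := by
    intro x hx y hy hxy
    refine hH.adj_of_reachable (M := M) (fun w hw => hw.2) (hNv x hx) (hNv y hy) hxy ?_
    obtain ⟨-, -, w, hw, hxw⟩ := Finset.mem_filter.1 hx
    obtain ⟨-, -, w', hw', hyw'⟩ := Finset.mem_filter.1 hy
    have hle : K ≤ edgesWithin H (insert x (insert y M)) := fun a b h =>
      ⟨h.1, Or.inr (Or.inr h.2.1), Or.inr (Or.inr h.2.2)⟩
    have h1 : (edgesWithin H (insert x (insert y M))).Adj x w :=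
      ⟨hxw, Or.inl rfl, Or.inr (Or.inr (hCM w hw))⟩
    have h2 : (edgesWithin H (insert x (insert y M))).Adj w' y :=
      ⟨hyw'.symm, Or.inr (Or.inr (hCM w' hw')), Or.inr (Or.inl rfl)⟩
    have h3 := ((Finset.mem_filter.1 hw).2.2.symm.trans (Finset.mem_filter.1 hw').2.2).mono hle
    exact h1.reachable.trans (h3.trans h2.reachable)
  have hvS' : v ∉ N ∪ C := by
    intro h
    rcases Finset.mem_union.1 h with h | h
    · exact (hNv v h).ne rfl
    · exact (hCM v h).2.1 rfl
  have hsub : N ∪ C ⊆ S := Finset.union_subset (Finset.filter_subset _ _) (Finset.filter_subset _ _)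
  have hss : N ∪ C ⊂ S := (Finset.ssubset_iff_of_subset hsub).2 ⟨v, hv, hvS'⟩
  have hCS : C ⊂ S := (Finset.ssubset_iff_of_subset (Finset.filter_subset _ _)).2
    ⟨v, hv, fun h => hvS' (Finset.mem_union_right _ h)⟩
  have hnb : ∀ w ∈ C, ∀ a ∈ S, H.Adj w a → a ∈ N ∪ C := by
    intro w hw a ha hwa
    by_cases haC : a ∈ C
    · exact Finset.mem_union_right _ haC
    · exact Finset.mem_union_left _ (Finset.mem_filter.2 ⟨ha, haC, w, hw, hwa.symm⟩)
  suffices h : ∃ w ∈ C, IsSimplicialIn H (N ∪ C) w by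
    obtain ⟨w, hw, hs⟩ := h
    exact ⟨w, (hCM w hw).1, (hCM w hw).2.1, (hCM w hw).2.2, fun a ha b hb hwa hwb hab =>
      hs a (hnb w hw a ha hwa) b (hnb w hw b hb hwb) hwa hwb hab⟩
  -- If `N` is joined to everything, simpliciality in `C` suffices. Otherwise induction at some `s ∈
  -- N` gives a simplicial non-neighbour of `s`, which lies in `C` since `N` is a clique.
  by_cases hdom : ∀ s ∈ N, ∀ u ∈ N ∪ C, u ≠ s → H.Adj s u
  · have hlift : ∀ w ∈ C, IsSimplicialIn H C w → IsSimplicialIn H (N ∪ C) w := by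
      intro w hw hs a ha b hb hwa hwb hab
      rcases Finset.mem_union.1 ha with ha' | ha'
      · exact hdom a ha' b hb hab.symm
      rcases Finset.mem_union.1 hb with hb' | hb'
      · exact (hdom b hb' a ha hab).symm
      exact hs a ha' b hb' hwa hwb hab
    by_cases hC : ∃ a ∈ C, ∃ b ∈ C, b ≠ a ∧ ¬ H.Adj a b
    · obtain ⟨a, ha, b, hb, hba, hnab⟩ := hC
      obtain ⟨w, hw, -, -, hs⟩ := ih C hCS a ha b hb hba hnab
      exact ⟨w, hw, hlift w hw hs⟩
    · push Not at hC
      exact ⟨c, hcC, hlift c hcC fun a ha b hb _ _ hab => hC a ha b hb hab.symm⟩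
  · push Not at hdom
    obtain ⟨s, hs, u, hu, hus, hsu⟩ := hdom
    obtain ⟨w, hw, hws, hsw, hsim⟩ := ih _ hss s (Finset.mem_union_left _ hs) u hu hus hsu
    refine ⟨w, ?_, hsim⟩
    rcases Finset.mem_union.1 hw with hw' | hw'
    · exact absurd (hN s hs w hw' hws.symm) hsw
    · exact hw'

theorem IsChordal.exists_isSimplicialIn (hH : IsChordal H) {S : Finset V} (hS : S.Nonempty) :
    ∃ w ∈ S, IsSimplicialIn H S w := by
  by_cases h : ∃ a ∈ S, ∃ b ∈ S, b ≠ a ∧ ¬ H.Adj a b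
  · obtain ⟨a, ha, b, hb, hba, hab⟩ := h
    obtain ⟨w, hw, -, -, hs⟩ := hH.exists_simplicial_nonneighbor S a ha b hb hba hab
    exact ⟨w, hw, hs⟩
  · push Not at h
    obtain ⟨w, hw⟩ := hS
    exact ⟨w, hw, fun a ha b hb _ _ hab => h a ha b hb hab.symm⟩

/-- Two edges of a graph with chordal complement are joined by an edge or share a vertex. -/
lemma exists_adj_of_isChordal_compl {G : SimpleGraph V} (hG : IsChordal Gᶜ) {a b c d : V}
    (hab : G.Adj a b) (hcd : G.Adj c d) (hac : a ≠ c) (had : a ≠ d) (hbc : b ≠ c) (hbd : b ≠ d) :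
    G.Adj a c ∨ G.Adj a d ∨ G.Adj b c ∨ G.Adj b d := by
  by_contra! h
  obtain ⟨h1, h2, h3, h4⟩ := h
  -- Otherwise `c, a, d, b` would span an induced 4-cycle of the complement.
  have key := hG.adj_of_reachable (v := c) (x := a) (y := b) (M := {d}) (by
    rintro w rfl
    exact ⟨hcd.ne', fun h => h.2 hcd⟩) ⟨hac.symm, fun h => h1 h.symm⟩
    ⟨hbc.symm, fun h => h3 h.symm⟩ hab.ne ?_
  · exact key.2 hab
  · have e1 : (edgesWithin Gᶜ (insert a (insert b {d}))).Adj a d :=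
      ⟨⟨had, h2⟩, by simp, by simp⟩
    have e2 : (edgesWithin Gᶜ (insert a (insert b {d}))).Adj d b :=
      ⟨⟨hbd.symm, fun h => h4 h.symm⟩, by simp, by simp⟩
    exact e1.reachable.trans e2.reachable

end Chordal

/-! ### Constructibility with tracked facet size -/

section Constructible

variable {α : Type*}

/-- Constructible complexes with facets of a given cardinality. -/
inductive IsConstructibleOfCard : ℕ → LowerSet (Finset α) → Prop
  | simplex (F : Finset α) : IsConstructibleOfCard F.card (LowerSet.Iic F)
  | union {d : ℕ} {Δ₁ Δ₂ : LowerSet (Finset α)} :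
      IsConstructibleOfCard (d + 1) Δ₁ → IsConstructibleOfCard (d + 1) Δ₂ →
      IsConstructibleOfCard d (Δ₁ ⊓ Δ₂) → IsConstructibleOfCard (d + 1) (Δ₁ ⊔ Δ₂)

lemma IsConstructibleOfCard.exists_card_eq {d : ℕ} {Δ : LowerSet (Finset α)}
    (h : IsConstructibleOfCard d Δ) :
    (∃ F, F ∈ Δ) ∧ ∀ F ∈ Δ, F.card ≤ d ∧ ∃ F' ∈ Δ, F ⊆ F' ∧ F'.card = d := by
  induction h with
  | simplex F =>
    exact ⟨⟨F, le_refl F⟩, fun F' hF' => ⟨Finset.card_le_card hF', F, le_refl F, hF', rfl⟩⟩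
  | union _ _ _ ih₁ ih₂ _ =>
    refine ⟨ih₁.1.imp fun F hF => Or.inl hF, ?_⟩
    rintro F (hF | hF)
    · obtain ⟨h, F', hF', h'⟩ := ih₁.2 F hF
      exact ⟨h, F', Or.inl hF', h'⟩
    · obtain ⟨h, F', hF', h'⟩ := ih₂.2 F hF
      exact ⟨h, F', Or.inr hF', h'⟩

lemma IsConstructibleOfCard.dim_eq {d : ℕ} {Δ : LowerSet (Finset α)}
    (h : IsConstructibleOfCard d Δ) : dim Δ = d - 1 := by
  obtain ⟨⟨F, hF⟩, h⟩ := h.exists_card_eq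
  obtain ⟨-, F', hF', -, hc⟩ := h F hF
  have : IsGreatest (Finset.card '' (Δ : Set (Finset α))) d :=
    ⟨⟨F', hF', hc⟩, by rintro _ ⟨F, hF, rfl⟩; exact (h F hF).1⟩
  rw [dim, this.csSup_eq]

lemma IsConstructibleOfCard.isPure {d : ℕ} {Δ : LowerSet (Finset α)}
    (h : IsConstructibleOfCard d Δ) : IsPure Δ := by
  have key : ∀ F, Maximal (· ∈ Δ) F → F.card = d := by
    intro F hF
    obtain ⟨-, F', hF', hs, hc⟩ := h.exists_card_eq.2 F hF.prop
    rw [← hc, hF.eq_of_le hF' hs]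
  intro F F' hF hF'
  rw [key F hF, key F' hF']

lemma IsConstructibleOfCard.isConstructible {d : ℕ} {Δ : LowerSet (Finset α)}
    (h : IsConstructibleOfCard d Δ) : IsConstructible Δ := by
  induction h with
  | simplex F => exact .simplex F
  | union h₁ h₂ h₃ ih₁ ih₂ ih₃ =>
    refine .union _ _ (IsConstructibleOfCard.union h₁ h₂ h₃).isPure ih₁ ih₂ ih₃ ?_ ?_
    · rw [h₁.dim_eq, h₂.dim_eq]
    · rw [h₂.dim_eq, h₃.dim_eq]
      push_cast
      ring

/-- The cone over `Δ` with apex `z`. -/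
def cone [DecidableEq α] (z : α) (Δ : LowerSet (Finset α)) : LowerSet (Finset α) where
  carrier := {s | s.erase z ∈ Δ}
  lower' _ _ hts hs := Δ.lower (Finset.erase_subset_erase z hts) hs

/-- Coning commutes with unions and intersections and turns a simplex into a simplex with one more
vertex. -/
lemma IsConstructibleOfCard.cone [DecidableEq α] {d : ℕ} {Δ : LowerSet (Finset α)}
    (h : IsConstructibleOfCard d Δ) {z : α} (hz : ∀ F ∈ Δ, z ∉ F) :
    IsConstructibleOfCard (d + 1) (cone z Δ) := by
  induction h with
  | simplex F =>
    have : LcmEdge.cone z (LowerSet.Iic F) = LowerSet.Iic (insert z F) := by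
      ext s
      exact Finset.subset_insert_iff.symm
    rw [this, ← Finset.card_insert_of_notMem (hz F (le_refl F))]
    exact .simplex _
  | union _ _ _ ih₁ ih₂ ih₃ =>
    exact .union (ih₁ fun F hF => hz F (Or.inl hF)) (ih₂ fun F hF => hz F (Or.inr hF))
      (ih₃ fun F hF => hz F (Or.inl hF.1))

end Constructible

/-! ### Chains of vertex sets without isolated vertices -/

section Chains

variable {V : Type*} {G : SimpleGraph V}

/-- The induced subgraph on `W` has no isolated vertices. -/
def HasNoIsolated (G : SimpleGraph V) (W : Finset V) : Prop :=
  ∀ v ∈ W, ∃ u ∈ W, G.Adj v u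

variable {P : Type*} [PartialOrder P] (f : P ↪o Finset V)

/-- The complex of chains all of whose members lie above a common member of `Z`. -/
def chainsAbove (Z : Finset (Finset V)) : LowerSet (Finset P) where
  carrier := {s | IsChain (· ≤ ·) (s : Set P) ∧ ∃ z ∈ Z, ∀ p ∈ s, z ⊆ f p}
  lower' _ _ hts hs := ⟨hs.1.mono (Finset.coe_subset.2 hts),
    hs.2.imp fun _ h => ⟨h.1, fun p hp => h.2 p (hts hp)⟩⟩

variable {f}

lemma mem_chainsAbove {Z : Finset (Finset V)} {s : Finset P} :
    s ∈ chainsAbove f Z ↔ IsChain (· ≤ ·) (s : Set P) ∧ ∃ z ∈ Z, ∀ p ∈ s, z ⊆ f p := Iff.rfl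

variable [DecidableEq V]

lemma HasNoIsolated.union {A B : Finset V} (hA : HasNoIsolated G A) (hB : HasNoIsolated G B) :
    HasNoIsolated G (A ∪ B) := by
  intro v hv
  rcases Finset.mem_union.1 hv with h | h
  · obtain ⟨u, hu, h⟩ := hA v h
    exact ⟨u, Finset.mem_union_left _ hu, h⟩
  · obtain ⟨u, hu, h⟩ := hB v h
    exact ⟨u, Finset.mem_union_right _ hu, h⟩

lemma hasNoIsolated_pair {a b : V} (h : G.Adj a b) : HasNoIsolated G {a, b} := by
  intro v hv
  rcases Finset.mem_insert.1 hv with rfl | hv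
  · exact ⟨b, by simp, h⟩
  · rw [Finset.mem_singleton.1 hv]
    exact ⟨a, by simp, h.symm⟩

lemma HasNoIsolated.insert {X : Finset V} (hX : HasNoIsolated G X) {a b : V} (hb : b ∈ X)
    (h : G.Adj a b) : HasNoIsolated G (insert a X) := by
  have := (hasNoIsolated_pair h).union hX
  rwa [Finset.insert_union, Finset.singleton_union, Finset.insert_eq_of_mem hb] at this

/-- Take an edge of `Y` with an end outside `X`. If it meets `X`, add that end; otherwise it is
joined by an edge to an edge inside `X`, and the end of the joining edge outside `X` can be added.
-/
lemma HasNoIsolated.exists_insert (hG : IsChordal Gᶜ) {X Y : Finset V} (hX : HasNoIsolated G X)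
    (hne : X.Nonempty) (hY : HasNoIsolated G Y) (hXY : X ⊂ Y) :
    ∃ a ∈ Y, a ∉ X ∧ HasNoIsolated G (Insert.insert a X) := by
  obtain ⟨y, hy, hyX⟩ := Finset.exists_of_ssubset hXY
  obtain ⟨y', hy', hyy'⟩ := hY y hy
  obtain ⟨x, hx⟩ := hne
  obtain ⟨x', hx', hxx'⟩ := hX x hx
  by_cases hy'X : y' ∈ X
  · exact ⟨y, hy, hyX, hX.insert hy'X hyy'⟩
  rcases exists_adj_of_isChordal_compl hG hxx' hyy' (fun h => hyX (h ▸ hx))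
    (fun h => hy'X (h ▸ hx)) (fun h => hyX (h ▸ hx')) (fun h => hy'X (h ▸ hx')) with h | h | h | h
  · exact ⟨y, hy, hyX, hX.insert hx h.symm⟩
  · exact ⟨y', hy', hy'X, hX.insert hx h.symm⟩
  · exact ⟨y, hy, hyX, hX.insert hx' h.symm⟩
  · exact ⟨y', hy', hy'X, hX.insert hx' h.symm⟩

lemma chainsAbove_insert (z : Finset V) (Z : Finset (Finset V)) :
    chainsAbove f (insert z Z) = chainsAbove f {z} ⊔ chainsAbove f Z := by
  ext s
  change s ∈ chainsAbove f _ ↔ s ∈ chainsAbove f _ ∨ s ∈ chainsAbove f _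
  simp only [mem_chainsAbove, Finset.exists_mem_insert, Finset.mem_singleton, exists_eq_left]
  tauto

lemma chainsAbove_singleton_inf (z : Finset V) (Z : Finset (Finset V)) :
    chainsAbove f {z} ⊓ chainsAbove f Z = chainsAbove f (Z.image (z ∪ ·)) := by
  ext s
  change s ∈ chainsAbove f _ ∧ s ∈ chainsAbove f _ ↔ s ∈ chainsAbove f _
  simp only [mem_chainsAbove, Finset.exists_mem_image, Finset.mem_singleton, exists_eq_left,
    Finset.union_subset_iff, forall_and]
  tauto

/-- `f` identifies `P` with the proper nonempty vertex sets without isolated vertices, `T` being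
the largest such set. -/
structure IsVertexSetPoset (G : SimpleGraph V) (T : Finset V) (f : P ↪o Finset V) : Prop where
  hasNoIsolated_top : HasNoIsolated G T
  subset_top : ∀ W, HasNoIsolated G W → W ⊆ T
  mem_range : ∀ W, (∃ p, f p = W) ↔ HasNoIsolated G W ∧ W.Nonempty ∧ W ≠ T

variable {T : Finset V}

/-- The element `p` is comparable to everything above it. What remains of a chain after deleting `p`
has, if nonempty, a least member strictly above `f p`, which contains a one-vertex extension by
`exists_insert`. -/
lemma IsVertexSetPoset.chainsAbove_eq_cone [DecidableEq P] (hG : IsChordal Gᶜ)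
    (hf : IsVertexSetPoset G T f) (p : P) {Z : Finset (Finset V)} (hZ : Z.Nonempty)
    (hZ' : ∀ y, y ∈ Z ↔ HasNoIsolated G y ∧ ∃ a ∉ f p, y = insert a (f p)) :
    chainsAbove f {f p} = cone p (chainsAbove f Z) := by
  obtain ⟨hp1, hp2, -⟩ := (hf.mem_range _).1 ⟨p, rfl⟩
  ext s
  change s ∈ chainsAbove f _ ↔ s.erase p ∈ chainsAbove f _
  simp only [mem_chainsAbove, Finset.mem_singleton, exists_eq_left]
  constructor
  · rintro ⟨hs, hps⟩
    have hch : IsChain (· ≤ ·) ((s.erase p : Finset P) : Set P) :=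
      hs.mono (Finset.coe_subset.2 (Finset.erase_subset p s))
    refine ⟨hch, ?_⟩
    rcases (s.erase p).eq_empty_or_nonempty with h0 | h0
    · obtain ⟨z, hz⟩ := hZ
      exact ⟨z, hz, by simp [h0]⟩
    · obtain ⟨q, hq⟩ := (s.erase p).exists_minimal h0
      have hqs := hq.prop
      have hlt : f p ⊂ f q := by
        refine lt_of_le_of_ne (hps q (Finset.mem_of_mem_erase hqs)) fun h => ?_
        exact Finset.ne_of_mem_erase hqs (f.injective h.symm)
      obtain ⟨a, ha, hap, h⟩ := hp1.exists_insert hG hp2 ((hf.mem_range _).1 ⟨q, rfl⟩).1 hlt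
      refine ⟨_, (hZ' _).2 ⟨h, a, hap, rfl⟩, fun r hr => ?_⟩
      have hqr : q ≤ r := by
        rcases hch.total hqs hr with h | h
        · exact h
        · exact hq.le_of_le hr h
      exact (Finset.insert_subset ha hlt.subset).trans (f.monotone hqr)
  · rintro ⟨hs, z, hz, hzs⟩
    obtain ⟨-, a, -, rfl⟩ := (hZ' z).1 hz
    have hps : ∀ q ∈ s, f p ⊆ f q := by
      intro q hq
      by_cases hqp : q = p
      · rw [hqp]
      · exact (Finset.subset_insert _ _).trans (hzs q (Finset.mem_erase.2 ⟨hqp, hq⟩))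
    refine ⟨?_, hps⟩
    refine (hs.insert (a := p) fun q hq _ =>
      Or.inl (f.le_iff_le.1 (hps q (Finset.mem_of_mem_erase hq)))).mono ?_
    rw [← Finset.coe_insert]
    exact Finset.coe_subset.2 (Finset.subset_insert_iff.2 subset_rfl)

/-- Facets have one set of each size from `X.card + 1` to `T.card - 1`, hence `m` members. `X`
itself may have isolated vertices, so that a single edge is covered by taking `X` to be one of its
ends. -/
lemma IsVertexSetPoset.isConstructibleOfCard_chainsAbove (hG : IsChordal Gᶜ)
    (hf : IsVertexSetPoset G T f) (m : ℕ) : ∀ (X : Finset V) (Z : Finset (Finset V)), Z.Nonempty →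
      (∀ z ∈ Z, HasNoIsolated G z ∧ ∃ a ∉ X, z = insert a X) → T.card = X.card + 1 + m →
      IsConstructibleOfCard m (chainsAbove f Z) := by
  classical
  induction m with
  | zero =>
    intro X Z hZ hZX hm
    have hzT : ∀ z ∈ Z, z = T := by
      intro z hz
      obtain ⟨hz1, a, ha, rfl⟩ := hZX z hz
      refine Finset.eq_of_subset_of_card_le (hf.subset_top _ hz1) ?_
      rw [Finset.card_insert_of_notMem ha, hm]
    -- `T` is not in the poset, so only the empty chain lies above it.
    have : chainsAbove f Z = LowerSet.Iic ∅ := by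
      ext s
      change s ∈ chainsAbove f _ ↔ s ⊆ ∅
      rw [mem_chainsAbove, Finset.subset_empty]
      constructor
      · rintro ⟨-, z, hz, h⟩
        refine Finset.eq_empty_of_forall_notMem fun p hp => ?_
        obtain ⟨h1, -, h2⟩ := (hf.mem_range _).1 ⟨p, rfl⟩
        exact h2 ((hf.subset_top _ h1).antisymm (hzT z hz ▸ h p hp))
      · rintro rfl
        obtain ⟨z, hz⟩ := hZ
        exact ⟨by simp, z, hz, by simp⟩
    rw [this]
    exact .simplex ∅
  | succ m ih =>
    intro X Z
    have hsingle : ∀ z, (HasNoIsolated G z ∧ ∃ a ∉ X, z = insert a X) →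
        T.card = X.card + 1 + (m + 1) → IsConstructibleOfCard (m + 1) (chainsAbove f {z}) := by
      rintro z ⟨hz, a, ha, hza⟩ hm
      have hcard : z.card = X.card + 1 := by rw [hza, Finset.card_insert_of_notMem ha]
      have hzne : z.Nonempty := Finset.card_pos.1 (by omega)
      have hzT : z ≠ T := by
        rintro rfl
        omega
      obtain ⟨p, rfl⟩ := (hf.mem_range z).2 ⟨hz, hzne, hzT⟩
      obtain ⟨b, hb, hbp, hb'⟩ := hz.exists_insert hG hzne hf.hasNoIsolated_top
        (lt_of_le_of_ne (hf.subset_top _ hz) hzT)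
      let Y := ((T \ f p).image (insert · (f p))).filter (HasNoIsolated G)
      have hY : ∀ y, y ∈ Y ↔ HasNoIsolated G y ∧ ∃ a ∉ f p, y = insert a (f p) := by
        intro y
        simp only [Y, Finset.mem_filter, Finset.mem_image, Finset.mem_sdiff]
        constructor
        · rintro ⟨⟨a, ⟨-, ha⟩, rfl⟩, h⟩
          exact ⟨h, a, ha, rfl⟩
        · rintro ⟨h, a, ha, rfl⟩
          exact ⟨⟨a, ⟨hf.subset_top _ h (Finset.mem_insert_self _ _), ha⟩, rfl⟩, h⟩
      have hYne : Y.Nonempty := ⟨_, (hY _).2 ⟨hb', b, hbp, rfl⟩⟩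
      rw [hf.chainsAbove_eq_cone hG p hYne hY]
      refine (ih (f p) Y hYne (fun y hy => (hY y).1 hy) (by omega)).cone ?_
      rintro s ⟨-, y, hy, hs⟩ hps
      obtain ⟨-, a, ha, rfl⟩ := (hY y).1 hy
      exact ha (hs p hps (Finset.mem_insert_self _ _))
    induction Z using Finset.induction_on with
    | empty => exact fun h => absurd h Finset.not_nonempty_empty
    | insert z Z hzZ ihZ =>
      intro _ hZX hm
      have hz := hZX z (Finset.mem_insert_self _ _)
      rcases Z.eq_empty_or_nonempty with rfl | hZ
      · exact hsingle z hz hm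
      have hZX' := fun y hy => hZX y (Finset.mem_insert_of_mem hy)
      rw [chainsAbove_insert]
      refine .union (hsingle z hz hm) (ihZ hZ hZX' hm) ?_
      rw [chainsAbove_singleton_inf]
      obtain ⟨hz1, a, ha, rfl⟩ := hz
      -- The intersection consists of chains above some `X ∪ {a, b}`, a one-vertex extension of `X ∪
      -- {a}`.
      refine ih (insert a X) _ (hZ.image _) ?_ (by rw [Finset.card_insert_of_notMem ha]; omega)
      intro y hy
      obtain ⟨y, hyZ, rfl⟩ := Finset.mem_image.1 hy
      obtain ⟨hy1, b, hb, rfl⟩ := hZX' y hyZ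
      refine ⟨hz1.union hy1, b, ?_, ?_⟩
      · intro h
        rcases Finset.mem_insert.1 h with rfl | h
        · exact hzZ hyZ
        · exact hb h
      · ext v
        simp only [Finset.mem_union, Finset.mem_insert]
        tauto

/-- Adding an edge to a set of edges with the property of linear quotients. -/
lemma IsVertexSetPoset.isConstructibleOfCard_insert (hG : IsChordal Gᶜ)
    (hf : IsVertexSetPoset G T f) {m : ℕ} (hm : T.card = m + 2) {u v : V} (huv : G.Adj u v)
    {D : Finset (Finset V)} (hD : ∀ e ∈ D, HasNoIsolated G e)
    (hDc : D.Nonempty → IsConstructibleOfCard m (chainsAbove f D))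
    (hlin : ∀ e ∈ D, ∃ e' ∈ D, (∃ a ∉ ({u, v} : Finset V), {u, v} ∪ e' = {a, u, v}) ∧
      e' ⊆ {u, v} ∪ e) :
    IsConstructibleOfCard m (chainsAbove f (insert {u, v} D)) := by
  classical
  have hs : IsConstructibleOfCard m (chainsAbove f {{u, v}}) := by
    refine hf.isConstructibleOfCard_chainsAbove hG m {v} {{u, v}} (by simp) ?_
      (by rw [Finset.card_singleton]; omega)
    intro z hz
    rw [Finset.mem_singleton.1 hz]
    exact ⟨hasNoIsolated_pair huv, u, by simpa using huv.ne, rfl⟩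
  rcases D.eq_empty_or_nonempty with rfl | hne
  · exact hs
  let E := D.filter fun e => ∃ a ∉ ({u, v} : Finset V), {u, v} ∪ e = {a, u, v}
  have hE : E.Nonempty := by
    obtain ⟨e, he⟩ := hne
    obtain ⟨e', he', h, -⟩ := hlin e he
    exact ⟨e', Finset.mem_filter.2 ⟨he', h⟩⟩
  -- By linear quotients, the three-element unions already generate the intersection.
  have hDE : chainsAbove f {{u, v}} ⊓ chainsAbove f D = chainsAbove f (E.image ({u, v} ∪ ·)) := by
    rw [← chainsAbove_singleton_inf]
    ext s
    change s ∈ chainsAbove f _ ∧ s ∈ chainsAbove f _ ↔ s ∈ chainsAbove f _ ∧ s ∈ chainsAbove f _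
    simp only [mem_chainsAbove, Finset.mem_singleton, exists_eq_left]
    constructor
    · rintro ⟨⟨hs, h1⟩, -, e, he, h2⟩
      obtain ⟨e', he', h, hsub⟩ := hlin e he
      exact ⟨⟨hs, h1⟩, hs, e', Finset.mem_filter.2 ⟨he', h⟩, fun p hp =>
        hsub.trans (Finset.union_subset (h1 p hp) (h2 p hp))⟩
    · rintro ⟨h1, hs, e, he, h2⟩
      exact ⟨h1, hs, e, (Finset.mem_filter.1 he).1, h2⟩
  have hE' : ∀ z ∈ E.image ({u, v} ∪ ·), HasNoIsolated G z ∧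
      ∃ a ∉ ({u, v} : Finset V), z = insert a {u, v} := by
    intro z hz
    obtain ⟨e, he, rfl⟩ := Finset.mem_image.1 hz
    obtain ⟨he, h⟩ := Finset.mem_filter.1 he
    exact ⟨(hasNoIsolated_pair huv).union (hD e he), h⟩
  have hcard : ({u, v} : Finset V).card = 2 := Finset.card_pair huv.ne
  -- `T` contains a three-element union, so `m` is positive.
  obtain ⟨m, rfl⟩ : ∃ k, m = k + 1 := by
    obtain ⟨z, hz⟩ := hE.image ({u, v} ∪ ·)
    obtain ⟨hz1, a, ha, rfl⟩ := hE' z hz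
    have := Finset.card_le_card (hf.subset_top _ hz1)
    rw [Finset.card_insert_of_notMem ha] at this
    exact ⟨m - 1, by omega⟩
  rw [chainsAbove_insert]
  refine .union hs (hDc hne) ?_
  rw [hDE]
  exact hf.isConstructibleOfCard_chainsAbove hG m {u, v} _ (hE.image _) hE' (by omega)

end Chains

/-! ### Linear quotients from a simplicial elimination order -/

section LinearQuotients

variable {V : Type*} {G : SimpleGraph V} [DecidableEq V]

/-- The linear quotients condition for adding the edge `{u, v}` to the set `D` of edges. -/
def LinearQuotient (D : Finset (Finset V)) (u v : V) : Prop :=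
  ∀ e ∈ D, ∃ e' ∈ D, (∃ a ∉ ({u, v} : Finset V), {u, v} ∪ e' = {a, u, v}) ∧ e' ⊆ {u, v} ∪ e

variable {P : Type*} [PartialOrder P] {f : P ↪o Finset V} {T : Finset V}

/-- Edges are added one by one. Two edges of the star share `v`, so their union has three vertices;
edges of `D` are handled by the hypothesis. -/
lemma IsVertexSetPoset.isConstructibleOfCard_union_star (hG : IsChordal Gᶜ)
    (hf : IsVertexSetPoset G T f) {m : ℕ} (hm : T.card = m + 2) {D : Finset (Finset V)}
    (hD : ∀ e ∈ D, HasNoIsolated G e)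
    (hDc : D.Nonempty → IsConstructibleOfCard m (chainsAbove f D)) (v : V) (A : Finset V) :
    (∀ u ∈ A, G.Adj v u ∧ LinearQuotient D v u) →
      (D ∪ A.image fun u => {v, u}).Nonempty →
      IsConstructibleOfCard m (chainsAbove f (D ∪ A.image fun u => {v, u})) := by
  induction A using Finset.induction_on with
  | empty =>
    rw [Finset.image_empty, Finset.union_empty]
    exact fun _ => hDc
  | insert u A hu ih =>
    intro hA _
    have hA' := fun w hw => hA w (Finset.mem_insert_of_mem hw)
    obtain ⟨hvu, hlin⟩ := hA u (Finset.mem_insert_self _ _)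
    rw [Finset.image_insert, Finset.union_insert]
    refine hf.isConstructibleOfCard_insert hG hm hvu ?_ (ih hA') ?_
    · intro e he
      rcases Finset.mem_union.1 he with he | he
      · exact hD e he
      · obtain ⟨w, hw, rfl⟩ := Finset.mem_image.1 he
        exact hasNoIsolated_pair (hA' w hw).1
    · intro e he
      rcases Finset.mem_union.1 he with he' | he'
      · obtain ⟨e', he', h⟩ := hlin e he'
        exact ⟨e', Finset.mem_union_left _ he', h⟩
      · obtain ⟨w, hw, rfl⟩ := Finset.mem_image.1 he'
        refine ⟨_, he, ⟨w, ?_, ?_⟩, Finset.subset_union_right⟩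
        · intro h
          rcases Finset.mem_insert.1 h with rfl | h
          · exact (hA' w hw).1.ne rfl
          · exact hu (Finset.mem_singleton.1 h ▸ hw)
        · ext x
          simp only [Finset.mem_union, Finset.mem_insert, Finset.mem_singleton]
          tauto

/-- Since `v` is simplicial in the complement, it cannot be non-adjacent in `G` to both ends of the
edge `xy`. An edge from `v` to one of these ends serves as `e'` for every edge of the star. -/
lemma LinearQuotient.union_star {D : Finset (Finset V)} {S : Finset V} {v : V}
    (hv : IsSimplicialIn Gᶜ S v) {A : Finset V} (hA : ∀ u, u ∈ A ↔ u ∈ S ∧ G.Adj v u)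
    {x y : V} (hx : x ∈ S) (hy : y ∈ S) (hxv : x ≠ v) (hyv : y ≠ v) (hxy : G.Adj x y)
    (h : LinearQuotient D x y) : LinearQuotient (D ∪ A.image fun u => {v, u}) x y := by
  intro e he
  rcases Finset.mem_union.1 he with he | he
  · obtain ⟨e', he', h⟩ := h e he
    exact ⟨e', Finset.mem_union_left _ he', h⟩
  obtain ⟨u, -, rfl⟩ := Finset.mem_image.1 he
  have hvxy : v ∉ ({x, y} : Finset V) := by simp [hxv.symm, hyv.symm]
  have key : ∃ w ∈ ({x, y} : Finset V), w ∈ A := by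
    by_contra! hno
    have h1 : ¬ G.Adj v x := fun h => hno x (by simp) ((hA x).2 ⟨hx, h⟩)
    have h2 : ¬ G.Adj v y := fun h => hno y (by simp) ((hA y).2 ⟨hy, h⟩)
    exact (hv x hx y hy ⟨hxv.symm, h1⟩ ⟨hyv.symm, h2⟩ hxy.ne).2 hxy
  obtain ⟨w, hw, hwA⟩ := key
  refine ⟨{v, w}, Finset.mem_union_right _ (Finset.mem_image.2 ⟨w, hwA, rfl⟩), ⟨v, hvxy, ?_⟩, ?_⟩
  · rw [Finset.union_insert, Finset.union_eq_left.2 (Finset.singleton_subset_iff.2 hw)]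
  · refine Finset.insert_subset (by simp) (Finset.singleton_subset_iff.2 ?_)
    exact Finset.mem_union_left _ hw

/-- `D` holds the edges already added and `S` the vertices not yet eliminated. Each step moves the
star of a simplicial vertex of the complement into `D`, while the target `E` stays fixed. -/
lemma IsVertexSetPoset.isConstructibleOfCard_edges (hG : IsChordal Gᶜ)
    (hf : IsVertexSetPoset G T f) {m : ℕ} (hm : T.card = m + 2) (S : Finset V) :
    ∀ D : Finset (Finset V), (∀ e ∈ D, HasNoIsolated G e) →
      (D.Nonempty → IsConstructibleOfCard m (chainsAbove f D)) →
      (∀ x ∈ S, ∀ y ∈ S, G.Adj x y → LinearQuotient D x y) →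
      ∀ E : Finset (Finset V),
        (∀ e, e ∈ E ↔ e ∈ D ∨ ∃ x ∈ S, ∃ y ∈ S, G.Adj x y ∧ e = {x, y}) → E.Nonempty →
        IsConstructibleOfCard m (chainsAbove f E) := by
  classical
  induction S using Finset.strongInduction with
  | H S ih =>
  intro D hD hDc hlin E hE hne
  rcases S.eq_empty_or_nonempty with rfl | hS
  · have : E = D := by
      ext e
      simp [hE]
    subst this
    exact hDc hne
  obtain ⟨v, hvS, hv⟩ := hG.exists_isSimplicialIn hS
  let A := S.filter (G.Adj v)
  have hA : ∀ u, u ∈ A ↔ u ∈ S ∧ G.Adj v u := fun u => Finset.mem_filter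
  refine ih (S.erase v) (Finset.erase_ssubset hvS) (D ∪ A.image fun u => {v, u}) ?_
    (hf.isConstructibleOfCard_union_star hG hm hD hDc v A fun u hu =>
      ⟨((hA u).1 hu).2, hlin v hvS u ((hA u).1 hu).1 ((hA u).1 hu).2⟩) ?_ E ?_ hne
  · intro e he
    rcases Finset.mem_union.1 he with he | he
    · exact hD e he
    · obtain ⟨w, hw, rfl⟩ := Finset.mem_image.1 he
      exact hasNoIsolated_pair ((hA w).1 hw).2
  · intro x hx y hy hxy
    obtain ⟨hxv, hx⟩ := Finset.mem_erase.1 hx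
    obtain ⟨hyv, hy⟩ := Finset.mem_erase.1 hy
    exact (hlin x hx y hy hxy).union_star hv hA hx hy hxv hyv hxy
  · intro e
    rw [hE, Finset.mem_union, Finset.mem_image, or_assoc]
    refine or_congr_right ?_
    constructor
    · rintro ⟨x, hx, y, hy, hxy, rfl⟩
      by_cases hxv : x = v
      · subst hxv
        exact Or.inl ⟨y, (hA y).2 ⟨hy, hxy⟩, rfl⟩
      by_cases hyv : y = v
      · subst hyv
        exact Or.inl ⟨x, (hA x).2 ⟨hx, hxy.symm⟩, Finset.pair_comm _ _⟩
      exact Or.inr ⟨x, Finset.mem_erase.2 ⟨hxv, hx⟩, y, Finset.mem_erase.2 ⟨hyv, hy⟩, hxy, rfl⟩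
    · rintro (⟨u, hu, rfl⟩ | ⟨x, hx, y, hy, h⟩)
      · exact ⟨v, hvS, u, ((hA u).1 hu).1, ((hA u).1 hu).2, rfl⟩
      · exact ⟨x, Finset.mem_of_mem_erase hx, y, Finset.mem_of_mem_erase hy, h⟩

theorem IsVertexSetPoset.isConstructible_orderComplex [Finite V] (hG : IsChordal Gᶜ)
    (hf : IsVertexSetPoset G T f) {a b : V} (hab : G.Adj a b) :
    IsConstructible (orderComplex P) := by
  classical
  have := Fintype.ofFinite V
  have h2 : 2 ≤ T.card := by
    rw [← Finset.card_pair hab.ne]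
    exact Finset.card_le_card (hf.subset_top _ (hasNoIsolated_pair hab))
  let E : Finset (Finset V) := Finset.univ.filter fun e => ∃ x y, G.Adj x y ∧ e = {x, y}
  have hE : {a, b} ∈ E := Finset.mem_filter.2 ⟨Finset.mem_univ _, a, b, hab, rfl⟩
  -- The least member of a nonempty chain contains an edge.
  have key : orderComplex P = chainsAbove f E := by
    ext s
    change IsChain _ _ ↔ s ∈ chainsAbove f _
    rw [mem_chainsAbove]
    refine ⟨fun hs => ⟨hs, ?_⟩, fun h => h.1⟩
    rcases s.eq_empty_or_nonempty with rfl | h0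
    · exact ⟨_, hE, by simp⟩
    obtain ⟨q, hq⟩ := s.exists_minimal h0
    obtain ⟨h1, ⟨x, hx⟩, -⟩ := (hf.mem_range _).1 ⟨q, rfl⟩
    obtain ⟨y, hy, hxy⟩ := h1 x hx
    refine ⟨{x, y}, Finset.mem_filter.2 ⟨Finset.mem_univ _, x, y, hxy, rfl⟩, fun r hr => ?_⟩
    have hqr : q ≤ r := by
      rcases hs.total hq.prop hr with h | h
      · exact h
      · exact hq.le_of_le hr h
    exact (Finset.insert_subset hx (Finset.singleton_subset_iff.2 hy)).trans (f.monotone hqr)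
  rw [key]
  refine (hf.isConstructibleOfCard_edges hG (m := T.card - 2) (by omega) Finset.univ ∅ (by simp)
    (by simp) (fun x _ y _ _ e he => absurd he (Finset.notMem_empty _)) E ?_
    ⟨_, hE⟩).isConstructible
  intro e
  simp [E]

end LinearQuotients

/-! ### The lcm-lattice as a lattice of vertex sets -/

section LcmLattice

variable {V : Type*}

/-- The exponent vector of the squarefree monomial with support `W`. -/
noncomputable def squarefreeExponent (W : Finset V) : V →₀ ℕ :=
  Finsupp.indicator W fun _ _ => 1

lemma mem_iff_squarefreeExponent {W : Finset V} {v : V} :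
    v ∈ W ↔ 1 ≤ squarefreeExponent W v := by
  classical
  by_cases h : v ∈ W <;> simp [squarefreeExponent, Finsupp.indicator_apply, h]

lemma squarefreeExponent_le_one (W : Finset V) (v : V) : squarefreeExponent W v ≤ 1 := by
  classical
  by_cases h : v ∈ W <;> simp [squarefreeExponent, Finsupp.indicator_apply, h]

lemma squarefreeExponent_le_iff {A : Finset V} {m : V →₀ ℕ} :
    squarefreeExponent A ≤ m ↔ ∀ v ∈ A, 1 ≤ m v := by
  constructor
  · exact fun h v hv => (mem_iff_squarefreeExponent.1 hv).trans (h v)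
  · intro h v
    by_cases hv : v ∈ A
    · exact (squarefreeExponent_le_one A v).trans (h v hv)
    · have := mt mem_iff_squarefreeExponent.2 hv
      omega

lemma squarefreeExponent_le_squarefreeExponent {A B : Finset V} :
    squarefreeExponent A ≤ squarefreeExponent B ↔ A ⊆ B := by
  rw [squarefreeExponent_le_iff]
  exact forall₂_congr fun v _ => mem_iff_squarefreeExponent.symm

lemma support_squarefreeExponent (W : Finset V) : (squarefreeExponent W).support = W := by
  ext v
  rw [Finsupp.mem_support_iff, mem_iff_squarefreeExponent, Nat.one_le_iff_ne_zero]

variable {k : Type*} [Field k] {G : SimpleGraph V} [DecidableEq V]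

lemma squarefreeExponent_pair {i j : V} (h : i ≠ j) :
    squarefreeExponent {i, j} = Finsupp.single i 1 + Finsupp.single j 1 := by
  ext v
  by_cases h1 : v = i <;> by_cases h2 : v = j <;>
    simp_all [squarefreeExponent, Finsupp.indicator_apply, Finsupp.single_apply, eq_comm]

lemma monomial_mem_edgeIdeal {a : V →₀ ℕ} :
    MvPolynomial.monomial a (1 : k) ∈ edgeIdeal k G ↔
      ∃ i j, G.Adj i j ∧ squarefreeExponent {i, j} ≤ a := by
  have : edgeIdeal k G = Ideal.span ((fun s => MvPolynomial.monomial s (1 : k)) ''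
      {m | ∃ i j, G.Adj i j ∧ m = squarefreeExponent {i, j}}) := by
    rw [edgeIdeal]
    congr 1
    ext p
    simp only [Set.mem_ofPred_eq, Set.mem_image]
    constructor
    · rintro ⟨i, j, h, rfl⟩
      refine ⟨_, ⟨i, j, h, rfl⟩, ?_⟩
      rw [squarefreeExponent_pair h.ne, MvPolynomial.X, MvPolynomial.X,
        MvPolynomial.monomial_mul, one_mul]
    · rintro ⟨_, ⟨i, j, h, rfl⟩, rfl⟩
      refine ⟨i, j, h, ?_⟩
      rw [squarefreeExponent_pair h.ne, MvPolynomial.X, MvPolynomial.X,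
        MvPolynomial.monomial_mul, one_mul]
  classical
  rw [this, MvPolynomial.mem_ideal_span_monomial_image, MvPolynomial.support_monomial,
    if_neg one_ne_zero]
  simp only [Finset.mem_singleton, forall_eq, Set.mem_ofPred_eq]
  constructor
  · rintro ⟨_, ⟨i, j, h, rfl⟩, hle⟩
    exact ⟨i, j, h, hle⟩
  · rintro ⟨i, j, h, hle⟩
    exact ⟨_, ⟨i, j, h, rfl⟩, hle⟩

lemma mem_minGens_edgeIdeal {m : V →₀ ℕ} :
    m ∈ minGens (edgeIdeal k G) ↔ ∃ i j, G.Adj i j ∧ m = squarefreeExponent {i, j} := by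
  rw [minGens, Set.mem_ofPred_eq]
  constructor
  · intro hm
    obtain ⟨i, j, h, hle⟩ := monomial_mem_edgeIdeal.1 hm.prop
    exact ⟨i, j, h, hm.eq_of_ge (monomial_mem_edgeIdeal.2 ⟨i, j, h, le_rfl⟩) hle⟩
  · rintro ⟨i, j, h, rfl⟩
    refine ⟨monomial_mem_edgeIdeal.2 ⟨i, j, h, le_rfl⟩, fun a ha hle => ?_⟩
    obtain ⟨i', j', h', hle'⟩ := monomial_mem_edgeIdeal.1 ha
    have hsub := squarefreeExponent_le_squarefreeExponent.1 (hle'.trans hle)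
    have heq := Finset.eq_of_subset_of_card_le hsub
      (by rw [Finset.card_pair h.ne, Finset.card_pair h'.ne])
    rwa [← heq]

/-- The lcm of squarefree monomials has the union of the supports as support, and a set without
isolated vertices is the union of the edges it contains. -/
lemma mem_lcmLattice_edgeIdeal [Finite V] {m : V →₀ ℕ} :
    m ∈ lcmLattice (edgeIdeal k G) ↔ ∃ W, HasNoIsolated G W ∧ m = squarefreeExponent W := by
  classical
  have := Fintype.ofFinite V
  constructor
  · rintro ⟨S, hS, rfl⟩
    induction S using Finset.induction_on with
    | empty =>
      refine ⟨∅, by simp [HasNoIsolated], ?_⟩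
      rw [Finset.sup_empty]
      exact bot_le.antisymm (squarefreeExponent_le_iff.2 (by simp))
    | insert a S _ ih =>
      obtain ⟨W, hW, hSW⟩ := ih fun b hb => hS b (Finset.mem_insert_of_mem hb)
      obtain ⟨i, j, hij, rfl⟩ := mem_minGens_edgeIdeal.1 (hS _ (Finset.mem_insert_self _ _))
      refine ⟨{i, j} ∪ W, (hasNoIsolated_pair hij).union hW, ?_⟩
      rw [Finset.sup_insert, hSW, id]
      refine le_antisymm (sup_le (squarefreeExponent_le_squarefreeExponent.2
        Finset.subset_union_left) (squarefreeExponent_le_squarefreeExponent.2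
        Finset.subset_union_right)) (squarefreeExponent_le_iff.2 fun v hv => ?_)
      rcases Finset.mem_union.1 hv with h | h
      · exact (mem_iff_squarefreeExponent.1 h).trans
          (le_sup_left (a := squarefreeExponent {i, j}) (b := squarefreeExponent W) v)
      · exact (mem_iff_squarefreeExponent.1 h).trans
          (le_sup_right (a := squarefreeExponent {i, j}) (b := squarefreeExponent W) v)
  · rintro ⟨W, hW, rfl⟩
    refine ⟨(W.powerset.filter fun e => ∃ i j, G.Adj i j ∧ e = {i, j}).image squarefreeExponent,
      ?_, ?_⟩
    · intro a ha
      obtain ⟨e, he, rfl⟩ := Finset.mem_image.1 ha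
      obtain ⟨-, i, j, h, rfl⟩ := Finset.mem_filter.1 he
      exact mem_minGens_edgeIdeal.2 ⟨i, j, h, rfl⟩
    · refine le_antisymm (squarefreeExponent_le_iff.2 fun v hv => ?_) (Finset.sup_le ?_)
      · obtain ⟨u, hu, huv⟩ := hW v hv
        have hmem : squarefreeExponent {v, u} ∈ (W.powerset.filter
            fun e => ∃ i j, G.Adj i j ∧ e = {i, j}).image squarefreeExponent :=
          Finset.mem_image_of_mem _ (Finset.mem_filter.2 ⟨Finset.mem_powerset.2
            (Finset.insert_subset hv (Finset.singleton_subset_iff.2 hu)), v, u, huv, rfl⟩)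
        exact (mem_iff_squarefreeExponent.1 (Finset.mem_insert_self v {u})).trans
          (Finset.le_sup (f := id) hmem v)
      · intro a ha
        obtain ⟨e, he, rfl⟩ := Finset.mem_image.1 ha
        exact squarefreeExponent_le_squarefreeExponent.2
          (Finset.mem_powerset.1 (Finset.mem_filter.1 he).1)

/-- The lcm-lattice of an edge ideal as a family of vertex sets. -/
noncomputable def lcmLatticeSupport [Finite V] : lcmLattice (edgeIdeal k G) ↪o Finset V :=
  OrderEmbedding.ofMapLEIff (fun x => x.1.support) <| by
    rintro ⟨x, hx⟩ ⟨y, hy⟩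
    obtain ⟨A, -, rfl⟩ := mem_lcmLattice_edgeIdeal.1 hx
    obtain ⟨B, -, rfl⟩ := mem_lcmLattice_edgeIdeal.1 hy
    rw [support_squarefreeExponent, support_squarefreeExponent]
    exact squarefreeExponent_le_squarefreeExponent.symm

lemma range_lcmLatticeSupport [Finite V] (W : Finset V) :
    (∃ x : lcmLattice (edgeIdeal k G), lcmLatticeSupport x = W) ↔ HasNoIsolated G W := by
  constructor
  · rintro ⟨⟨x, hx⟩, rfl⟩
    obtain ⟨A, hA, rfl⟩ := mem_lcmLattice_edgeIdeal.1 hx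
    change HasNoIsolated G (squarefreeExponent A).support
    rwa [support_squarefreeExponent]
  · exact fun h => ⟨⟨_, mem_lcmLattice_edgeIdeal.2 ⟨W, h, rfl⟩⟩, support_squarefreeExponent W⟩

lemma isVertexSetPoset_properPart [Finite V] {T : Finset V} (hT : HasNoIsolated G T)
    (hT' : ∀ W, HasNoIsolated G W → W ⊆ T) :
    IsVertexSetPoset G T ((OrderEmbedding.subtype _).trans lcmLatticeSupport :
      ProperPart (lcmLattice (edgeIdeal k G)) ↪o Finset V) where
  hasNoIsolated_top := hT
  subset_top := hT'
  mem_range W := by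
    obtain ⟨b, hb⟩ := (range_lcmLatticeSupport (k := k) (G := G) ∅).2 (by simp [HasNoIsolated])
    obtain ⟨t, ht⟩ := (range_lcmLatticeSupport (k := k) T).2 hT
    have hle : ∀ {x y : lcmLattice (edgeIdeal k G)},
      lcmLatticeSupport x ⊆ lcmLatticeSupport y ↔ x ≤ y := lcmLatticeSupport.le_iff_le
    have hbot : ∀ x : lcmLattice (edgeIdeal k G), IsBot x ↔ lcmLatticeSupport x = ∅ := by
      intro x
      constructor
      · intro h
        exact Finset.subset_empty.1 (hb ▸ hle.2 (h b))
      · intro h y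
        exact hle.1 (h ▸ Finset.empty_subset _)
    have htop : ∀ x : lcmLattice (edgeIdeal k G), IsTop x ↔ lcmLatticeSupport x = T := by
      intro x
      constructor
      · intro h
        exact (hT' _ ((range_lcmLatticeSupport _).1 ⟨x, rfl⟩)).antisymm (ht ▸ hle.2 (h t))
      · intro h y
        exact hle.1 (h ▸ hT' _ ((range_lcmLatticeSupport _).1 ⟨y, rfl⟩))
    constructor
    · rintro ⟨⟨x, h1, h2⟩, rfl⟩
      exact ⟨(range_lcmLatticeSupport _).1 ⟨x, rfl⟩,
        Finset.nonempty_iff_ne_empty.2 (mt (hbot x).2 h1), mt (htop x).2 h2⟩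
    · rintro ⟨h, h1, h2⟩
      obtain ⟨x, rfl⟩ := (range_lcmLatticeSupport (k := k) W).2 h
      exact ⟨⟨x, mt (hbot x).1 (Finset.nonempty_iff_ne_empty.1 h1), mt (htop x).1 h2⟩, rfl⟩

end LcmLattice

end LcmEdge

theorem mainTheorem6 {k : Type*} [Field k] {V : Type*} [Finite V] (G : SimpleGraph V)
    (hG : LcmEdge.IsChordal Gᶜ) :
    LcmEdge.IsConstructible
      (LcmEdge.orderComplex (LcmEdge.ProperPart (LcmEdge.lcmLattice (LcmEdge.edgeIdeal k G)))) := by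
  classical
  have := Fintype.ofFinite V
  let T : Finset V := Finset.univ.filter fun v => ∃ u, G.Adj v u
  have hT : LcmEdge.HasNoIsolated G T := by
    intro v hv
    obtain ⟨-, u, hvu⟩ := Finset.mem_filter.1 hv
    exact ⟨u, Finset.mem_filter.2 ⟨Finset.mem_univ _, v, hvu.symm⟩, hvu⟩
  have hT' : ∀ W, LcmEdge.HasNoIsolated G W → W ⊆ T := by
    intro W hW v hv
    obtain ⟨u, -, hvu⟩ := hW v hv
    exact Finset.mem_filter.2 ⟨Finset.mem_univ _, u, hvu⟩
  have hf := LcmEdge.isVertexSetPoset_properPart (k := k) hT hT'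
  by_cases hE : ∃ a b, G.Adj a b
  · obtain ⟨a, b, hab⟩ := hE
    exact hf.isConstructible_orderComplex hG hab
  -- Without edges the lattice is `{1}`; its proper part is empty and the complex is `{∅}`.
  · have hempty : IsEmpty (LcmEdge.ProperPart (LcmEdge.lcmLattice (LcmEdge.edgeIdeal k G))) := by
      refine ⟨fun x => ?_⟩
      obtain ⟨h, ⟨v, hv⟩, -⟩ := (hf.mem_range _).1 ⟨x, rfl⟩
      obtain ⟨u, -, hvu⟩ := h v hv
      exact hE ⟨v, u, hvu⟩
    have : LcmEdge.orderComplex (LcmEdge.ProperPart (LcmEdge.lcmLattice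
        (LcmEdge.edgeIdeal k G))) = LowerSet.Iic ∅ := by
      ext s
      rw [Finset.eq_empty_of_isEmpty s]
      exact ⟨fun _ => le_refl (∅ : Finset _), fun _ => by simp [LcmEdge.orderComplex]⟩
    rw [this]
    exact .simplex ∅
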